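/- Let $n \ge 0$ be an integer. For $\theta \in \mathbb{R}^n$ and a real symmetric positive definite $n \times n$ matrix $\Sigma$, let $N(\theta,\Sigma)$ denote the Gaussian probability measure on $\mathbb{R}^n$ with mean vector $\theta$ and covariance matrix $\Sigma$, and let $I$ be the identity matrix. Let $T:\mathbb{R}^n\to\mathbb{R}^n$ be a Borel automorphism, i.e. a bijection such that $T$ and $T^{-1}$ are Borel measurable; for a Borel measure $\mu$ write $\mu T^{-1}$ for the image measure $E\mapsto\mu(T^{-1}(E))$. Let $\theta_0,\theta_1,\dots,\theta_n\in\mathbb{R}^n$ be such that $\theta_1-\theta_0,\dots,\theta_n-\theta_0$ is a basis of $\mathbb{R}^n$. Suppose that there are $\varphi_0,\dots,\varphi_n\in\mathbb{R}^n$ and positive definite matrices $\Psi_0,\dots,\Psi_n$ with $$N(\theta_j,I)\,T^{-1}=N(\varphi_j,\Psi_j),\qquad 0\le j\le n.$$ Then there are an invertible real $n\times n$ matrix $A$ and a vector $a\in\mathbb{R}^n$ such that $T(x)=Ax+a$ for Lebesgue-almost every $x\in\mathbb{R}^n$. -/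

import Mathlib

/-! Densities are compared on the two sides of `T`. The log-likelihood ratio of `N(θ_j, I)` against
`N(θ_0, I)` is the affine function `⟪θ_j - θ_0, x⟫ + const`, and that of the images is a polynomial
`k_j` of degree at most two, the difference of two Gaussian exponents. Since `T` is an isomorphism
of measurable spaces, `⟪θ_j - θ_0, x⟫ + const = k_j (T x)` for almost every `x`
(`ae_eq_comp_of_map_withDensity_eq`).

Under a Gaussian measure an affine function has finite exponential moments of every real order `t`
(`lintegral_exp_mul_inner_gaussian_lt_top`), hence so does `k_j` under `N(φ_0, Ψ_0)`. Thus the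
exponential of the Gaussian exponent plus `t * k_j` is Lebesgue integrable for all `t`, and its
quadratic part is negative semidefinite for all `t` (`nonpos_of_lintegral_exp_lt_top`), which is
possible only if the quadratic part of `k_j` is zero. So `k_j` is affine
(`exists_affine_logLikelihoodRatio`).

The result is a system `G x = H (T x) + const` almost everywhere, with `G` and `H` linear and `G`
invertible because the `θ_j - θ_0` form a basis. Comparing the equation at `x` and at a translate of
`x` shows that the range of `H` contains that of `G`, so `H` is invertible as well and `T` is almost
everywhere equal to an invertible affine map (`exists_linearEquiv_of_ae_eq`). -/

open MeasureTheory ProbabilityTheory Real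
open scoped RealInnerProductSpace ENNReal

/-! ### Densities of Gaussian measures -/

section Density

variable {E : Type*} [NormedAddCommGroup E] [InnerProductSpace ℝ E] [FiniteDimensional ℝ E]
  [MeasurableSpace E] [BorelSpace E]

lemma lintegral_exp_neg_half_sq_norm :
    ∫⁻ x : E, ENNReal.ofReal (exp (-‖x‖ ^ 2 / 2)) =
      ENNReal.ofReal ((2 * π) ^ (Module.finrank ℝ E / 2 : ℝ)) := by
  have h := GaussianFourier.integral_rexp_neg_mul_sq_norm (V := E) (b := 1 / 2) (by norm_num)
  have e : ∀ x : E, exp (-(1 / 2) * ‖x‖ ^ 2) = exp (-‖x‖ ^ 2 / 2) := fun x ↦ by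
    congr 1; ring
  simp_rw [e] at h
  rw [← ofReal_integral_eq_lintegral_ofReal _ (.of_forall fun x ↦ (exp_pos _).le), h]
  · congr 2; ring
  · by_contra hi
    rw [integral_undef hi] at h
    have : 0 < (π / (1 / 2)) ^ (Module.finrank ℝ E / 2 : ℝ) := by positivity
    exact this.ne h

/-- The proof compares characteristic functions, using the Fourier transform of
`exp (-‖x‖ ^ 2 / 2)`. -/
lemma stdGaussian_eq_withDensity :
    ∃ c : ℝ, stdGaussian E =
      volume.withDensity (fun x ↦ ENNReal.ofReal (exp (c - ‖x‖ ^ 2 / 2))) := by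
  set k : ℝ := (2 * π) ^ (Module.finrank ℝ E / 2 : ℝ) with hk
  have hk0 : 0 < k := by positivity
  have hexp : ∀ x : E, exp (-log k - ‖x‖ ^ 2 / 2) = k⁻¹ * exp (-‖x‖ ^ 2 / 2) := fun x ↦ by
    rw [sub_eq_add_neg, exp_add, exp_neg, exp_log hk0, neg_div]
  refine ⟨-log k, ?_⟩
  have hfin : IsFiniteMeasure
      ((volume : Measure E).withDensity
        (fun x ↦ ENNReal.ofReal (exp (-log k - ‖x‖ ^ 2 / 2)))) := by
    refine isFiniteMeasure_withDensity ?_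
    simp_rw [hexp, ENNReal.ofReal_mul (inv_nonneg.2 hk0.le)]
    rw [lintegral_const_mul _ (by fun_prop), lintegral_exp_neg_half_sq_norm]
    exact ENNReal.mul_ne_top ENNReal.ofReal_ne_top ENNReal.ofReal_ne_top
  apply Measure.ext_of_charFun
  ext t
  rw [charFun_stdGaussian, charFun_apply,
    integral_withDensity_eq_integral_toReal_smul (by fun_prop) (by simp)]
  have h := GaussianFourier.integral_cexp_neg_mul_sq_norm_add (V := E) (b := 1 / 2)
    (by norm_num) Complex.I t
  have e : ∀ x : E, (ENNReal.ofReal (exp (-log k - ‖x‖ ^ 2 / 2))).toReal •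
      Complex.exp (⟪x, t⟫ * Complex.I) =
      (k⁻¹ : ℂ) * Complex.exp (-(1 / 2) * ‖x‖ ^ 2 + Complex.I * ⟪t, x⟫) := fun x ↦ by
    rw [ENNReal.toReal_ofReal (exp_pos _).le, hexp, Complex.exp_add, real_inner_comm]
    simp only [Complex.real_smul, Complex.ofReal_mul, Complex.ofReal_exp, Complex.ofReal_inv]
    push_cast
    rw [mul_assoc]
    congr 3
    · ring_nf
    · ring_nf
  simp_rw [e]
  rw [integral_const_mul, h, ← mul_assoc]
  have hkc : ((π : ℂ) / (1 / 2)) ^ (Module.finrank ℝ E / 2 : ℂ) = k := by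
    rw [hk, Complex.ofReal_cpow (by positivity)]
    push_cast
    congr 1; ring
  rw [hkc, inv_mul_cancel₀ (by exact_mod_cast hk0.ne'), one_mul, Complex.I_sq]
  congr 1; ring

lemma map_stdGaussian_affine_eq_withDensity (m : E) (R : E ≃L[ℝ] E) :
    ∃ c : ℝ, (stdGaussian E).map (fun x ↦ m + R x) =
      volume.withDensity (fun x ↦ ENNReal.ofReal (exp (c - ‖R.symm (x - m)‖ ^ 2 / 2))) := by
  obtain ⟨c, hc⟩ := stdGaussian_eq_withDensity (E := E)
  have hdet : LinearMap.det (R.toLinearEquiv : E →ₗ[ℝ] E) ≠ 0 :=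
    (LinearEquiv.isUnit_det' R.toLinearEquiv).ne_zero
  have hvol : (volume : Measure E).map (fun x ↦ m + R x) =
      ENNReal.ofReal |(LinearMap.det (R.toLinearEquiv : E →ₗ[ℝ] E))⁻¹| • volume := by
    have h1 : (fun x ↦ m + R x) = (fun x ↦ m + x) ∘ (R.toLinearEquiv : E →ₗ[ℝ] E) := rfl
    have h2 : Measurable (R.toLinearEquiv : E →ₗ[ℝ] E) := R.continuous.measurable
    rw [h1, ← Measure.map_map (by fun_prop) h2,
      Measure.map_linearMap_addHaar_eq_smul_addHaar _ hdet, Measure.map_smul,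
      map_add_left_eq_self]
  set d := |(LinearMap.det (R.toLinearEquiv : E →ₗ[ℝ] E))⁻¹|
  have hd : 0 < d := abs_pos.2 (inv_ne_zero hdet)
  refine ⟨c + log d, ?_⟩
  have hmeas : Measurable (fun x ↦ m + R x) := by fun_prop
  have hcomp : (fun x : E ↦ ENNReal.ofReal (exp (c - ‖x‖ ^ 2 / 2))) =
      (fun y ↦ ENNReal.ofReal (exp (c - ‖R.symm (y - m)‖ ^ 2 / 2))) ∘ (fun x ↦ m + R x) := by
    ext x; simp
  ext s hs
  rw [Measure.map_apply hmeas hs, hc, withDensity_apply _ (hmeas hs), hcomp,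
    withDensity_apply _ hs]
  refine (setLIntegral_map (f := fun y ↦ ENNReal.ofReal (exp (c - ‖R.symm (y - m)‖ ^ 2 / 2)))
    hs (by fun_prop) hmeas).symm.trans ?_
  rw [hvol, Measure.restrict_smul, lintegral_smul_measure, smul_eq_mul,
    ← lintegral_const_mul _ (by fun_prop)]
  refine lintegral_congr fun x ↦ ?_
  rw [← ENNReal.ofReal_mul hd.le, add_sub_right_comm, exp_add, exp_log hd, mul_comm]

end Density

open scoped MatrixOrder in
/-- The witness `B` is the inverse of the square root of `S`, so that `‖B v‖ ^ 2` is the quadratic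
form of `S⁻¹`. -/
lemma multivariateGaussian_eq_withDensity {ι : Type*} [Fintype ι] [DecidableEq ι]
    (m : EuclideanSpace ℝ ι) {S : Matrix ι ι ℝ} (hS : S.PosDef) :
    ∃ (B : EuclideanSpace ℝ ι →L[ℝ] EuclideanSpace ℝ ι) (c : ℝ), multivariateGaussian m S =
      volume.withDensity (fun x ↦ ENNReal.ofReal (exp (c - ‖B (x - m)‖ ^ 2 / 2))) := by
  have hU : IsUnit (CFC.sqrt S) := by
    have h := hS.isUnit
    rw [← CFC.sqrt_mul_sqrt_self S hS.posSemidef.nonneg] at h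
    exact ((Commute.refl _).isUnit_mul_iff.1 h).1
  obtain ⟨u, hu⟩ := hU.map (Matrix.toEuclideanCLM (n := ι) (𝕜 := ℝ))
  obtain ⟨c, hc⟩ := map_stdGaussian_affine_eq_withDensity m
    (ContinuousLinearEquiv.unitsEquiv ℝ _ u)
  refine ⟨(ContinuousLinearEquiv.unitsEquiv ℝ _ u).symm, c, ?_⟩
  rw [multivariateGaussian, ← hu]
  exact hc

/-! ### Integrability of exponentials -/

/-- If `exp ∘ p` has a finite Lebesgue integral `I`, then `p` cannot have a positive second
difference `2 * q` in a fixed direction `v`: translation invariance and the inequality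
`exp a + exp b ≥ 2 * exp ((a + b) / 2)` give `2 * I ≥ 2 * exp q * I`. For a quadratic polynomial
`p` this says that its quadratic part is negative semidefinite. -/
lemma nonpos_of_lintegral_exp_lt_top {E : Type*} [NormedAddCommGroup E] [InnerProductSpace ℝ E]
    [FiniteDimensional ℝ E] [MeasurableSpace E] [BorelSpace E] {p : E → ℝ}
    (hp : Measurable p) {v : E} {q : ℝ}
    (hpq : ∀ y, p (y + v) + p (y - v) = 2 * p y + 2 * q)
    (hfin : ∫⁻ y, ENNReal.ofReal (exp (p y)) < ∞) : q ≤ 0 := by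
  have hI : ∫⁻ y, ENNReal.ofReal (exp (p y)) ≠ 0 := by
    rw [Ne, lintegral_eq_zero_iff (by fun_prop)]
    intro h
    obtain ⟨y, hy⟩ := h.exists
    exact (exp_pos (p y)).not_ge (ENNReal.ofReal_eq_zero.1 hy)
  have key : ENNReal.ofReal (2 * exp q) * ∫⁻ y, ENNReal.ofReal (exp (p y)) ≤
      ENNReal.ofReal 2 * ∫⁻ y, ENNReal.ofReal (exp (p y)) := by
    calc _ = ∫⁻ y, ENNReal.ofReal (2 * exp q * exp (p y)) := by
          rw [← lintegral_const_mul _ (by fun_prop)]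
          simp_rw [ENNReal.ofReal_mul (show 0 ≤ 2 * exp q by positivity)]
      _ ≤ ∫⁻ y, (ENNReal.ofReal (exp (p (y + v))) + ENNReal.ofReal (exp (p (y - v)))) := by
          refine lintegral_mono fun y ↦ ?_
          rw [← ENNReal.ofReal_add (exp_pos _).le (exp_pos _).le]
          refine ENNReal.ofReal_le_ofReal ?_
          set a := p (y + v)
          set b := p (y - v)
          have h1 : exp q * exp (p y) = exp (a / 2) * exp (b / 2) := by
            rw [← exp_add, ← exp_add]; congr 1; linarith [hpq y]
          have h2 : exp a = exp (a / 2) ^ 2 := by rw [← exp_nat_mul]; congr 1; push_cast; ring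
          have h3 : exp b = exp (b / 2) ^ 2 := by rw [← exp_nat_mul]; congr 1; push_cast; ring
          rw [h2, h3, mul_assoc, h1]
          linarith [two_mul_le_add_sq (exp (a / 2)) (exp (b / 2))]
      _ = _ := by
          rw [lintegral_add_left (by fun_prop),
            lintegral_add_right_eq_self (fun y ↦ ENNReal.ofReal (exp (p y))) v,
            lintegral_sub_right_eq_self (fun y ↦ ENNReal.ofReal (exp (p y))) v]
          rw [ENNReal.ofReal_ofNat, two_mul]
  rw [ENNReal.mul_le_mul_iff_left hI hfin.ne, ENNReal.ofReal_le_ofReal_iff (by norm_num)] at key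
  rw [← exp_le_one_iff]
  linarith

lemma lintegral_exp_mul_inner_gaussian_lt_top {E : Type*} [NormedAddCommGroup E]
    [InnerProductSpace ℝ E] [MeasurableSpace E] [BorelSpace E] (ν : Measure E) [IsGaussian ν]
    (w : E) (α t : ℝ) :
    ∫⁻ x, ENNReal.ofReal (exp (t * (⟪w, x⟫ + α))) ∂ν < ∞ := by
  have h1 : Integrable (fun y : ℝ ↦ exp (t * y)) (ν.map (innerSL ℝ w)) := by
    rw [IsGaussian.map_eq_gaussianReal (innerSL ℝ w)]
    exact integrable_exp_mul_gaussianReal t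
  rw [integrable_map_measure (by fun_prop) (by fun_prop)] at h1
  have h2 : Integrable (fun x ↦ exp (t * (⟪w, x⟫ + α))) ν := by
    refine (h1.mul_const (exp (t * α))).congr (.of_forall fun x ↦ ?_)
    simp only [Function.comp_apply, innerSL_apply_apply]
    rw [← exp_add, mul_add]
  exact h2.lintegral_lt_top

/-! ### Log-likelihood ratios -/

lemma ae_eq_comp_of_map_withDensity_eq {X Y : Type*} [MeasurableSpace X] [MeasurableSpace Y]
    {ν : Measure X} [SigmaFinite ν] (T : X ≃ᵐ Y) {r : X → ℝ≥0∞} {s : Y → ℝ≥0∞}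
    (hr : Measurable r) (hs : Measurable s)
    (h : (ν.withDensity r).map T = (ν.map T).withDensity s) :
    ∀ᵐ x ∂ν, r x = s (T x) := by
  refine (withDensity_eq_iff_of_sigmaFinite hr.aemeasurable
    (hs.comp T.measurable).aemeasurable).1 ?_
  ext A hA
  have hTA : MeasurableSet (T.symm ⁻¹' A) := T.symm.measurable hA
  have hA' : T ⁻¹' (T.symm ⁻¹' A) = A := by ext x; simp
  have h2 := congrArg (fun μ ↦ μ (T.symm ⁻¹' A)) h
  rw [Measure.map_apply T.measurable hTA, hA', withDensity_apply _ hTA,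
    setLIntegral_map hTA hs T.measurable, hA'] at h2
  rw [h2, withDensity_apply _ hA]
  rfl

lemma withDensity_exp_sub {X : Type*} [MeasurableSpace X] {μ : Measure X} {f g : X → ℝ}
    (hf : Measurable f) (hg : Measurable g) :
    μ.withDensity (fun x ↦ ENNReal.ofReal (exp (g x))) =
      (μ.withDensity (fun x ↦ ENNReal.ofReal (exp (f x)))).withDensity
        (fun x ↦ ENNReal.ofReal (exp (g x - f x))) := by
  rw [← withDensity_mul _ (by fun_prop) (by fun_prop)]
  congr 1
  ext x
  rw [Pi.mul_apply, ← ENNReal.ofReal_mul (exp_pos _).le, ← exp_add]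
  congr 2; ring

/-- The log-likelihood ratio of the two source measures is affine in `x`, that of the two images is
a polynomial `k` of degree at most two in `T x`, and they agree almost everywhere. As the former
has exponential moments of all orders, so has `k` under the image measure, which forces the
quadratic part of `k` to vanish. -/
lemma exists_affine_logLikelihoodRatio {ι : Type*} [Fintype ι] [DecidableEq ι]
    (T : EuclideanSpace ℝ ι ≃ᵐ EuclideanSpace ℝ ι) {θ₀ θ₁ φ₀ φ₁ : EuclideanSpace ℝ ι}
    {S₀ S₁ : Matrix ι ι ℝ} (hS₀ : S₀.PosDef) (hS₁ : S₁.PosDef)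
    (h₀ : (multivariateGaussian θ₀ 1).map T = multivariateGaussian φ₀ S₀)
    (h₁ : (multivariateGaussian θ₁ 1).map T = multivariateGaussian φ₁ S₁) :
    ∃ (w : EuclideanSpace ℝ ι) (γ : ℝ), ∀ᵐ x, ⟪θ₁ - θ₀, x⟫ = ⟪w, T x⟫ + γ := by
  have hstd : ∀ m : EuclideanSpace ℝ ι, ∃ c : ℝ, multivariateGaussian m 1 =
      volume.withDensity (fun x ↦ ENNReal.ofReal (exp (c - ‖x - m‖ ^ 2 / 2))) := fun m ↦ by
    obtain ⟨c, hc⟩ := map_stdGaussian_affine_eq_withDensity m (.refl ℝ (EuclideanSpace ℝ ι))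
    refine ⟨c, ?_⟩
    simpa [multivariateGaussian] using hc
  obtain ⟨a₀, ha₀⟩ := hstd θ₀
  obtain ⟨a₁, ha₁⟩ := hstd θ₁
  obtain ⟨B₀, c₀, hc₀⟩ := multivariateGaussian_eq_withDensity φ₀ hS₀
  obtain ⟨B₁, c₁, hc₁⟩ := multivariateGaussian_eq_withDensity φ₁ hS₁
  set ν := multivariateGaussian θ₀ (1 : Matrix ι ι ℝ)
  let k : EuclideanSpace ℝ ι → ℝ := fun y ↦
    (c₁ - ‖B₁ (y - φ₁)‖ ^ 2 / 2) - (c₀ - ‖B₀ (y - φ₀)‖ ^ 2 / 2)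
  have hk : Measurable k := by fun_prop
  obtain ⟨α, hα⟩ : ∃ α : ℝ, ∀ x : EuclideanSpace ℝ ι,
      (a₁ - ‖x - θ₁‖ ^ 2 / 2) - (a₀ - ‖x - θ₀‖ ^ 2 / 2) = ⟪θ₁ - θ₀, x⟫ + α := by
    refine ⟨a₁ - a₀ - ‖θ₁‖ ^ 2 / 2 + ‖θ₀‖ ^ 2 / 2, fun x ↦ ?_⟩
    rw [norm_sub_sq_real, norm_sub_sq_real, inner_sub_left, real_inner_comm x, real_inner_comm x]
    ring
  have hae : ∀ᵐ x ∂ν, ⟪θ₁ - θ₀, x⟫ + α = k (T x) := by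
    have h := ae_eq_comp_of_map_withDensity_eq (ν := ν) T
      (r := fun x ↦ ENNReal.ofReal (exp ((a₁ - ‖x - θ₁‖ ^ 2 / 2) - (a₀ - ‖x - θ₀‖ ^ 2 / 2))))
      (s := fun y ↦ ENNReal.ofReal (exp (k y))) (by fun_prop) (by fun_prop) (by
        rw [h₀, hc₀, ha₀, ← withDensity_exp_sub (by fun_prop) (by fun_prop),
          ← withDensity_exp_sub (by fun_prop) (by fun_prop), ← ha₁, ← hc₁, h₁])
    filter_upwards [h] with x hx
    rwa [hα, ENNReal.ofReal_eq_ofReal_iff (exp_pos _).le (exp_pos _).le, exp_eq_exp] at hx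
  have hfin : ∀ t : ℝ, ∫⁻ y, ENNReal.ofReal
      (exp ((c₀ - ‖B₀ (y - φ₀)‖ ^ 2 / 2) + t * k y)) < ∞ := fun t ↦ by
    have h1 := lintegral_exp_mul_inner_gaussian_lt_top ν (θ₁ - θ₀) α t
    have h2 : ∫⁻ x, ENNReal.ofReal (exp (t * (⟪θ₁ - θ₀, x⟫ + α))) ∂ν =
        ∫⁻ x, ENNReal.ofReal (exp (t * k (T x))) ∂ν := by
      refine lintegral_congr_ae ?_
      filter_upwards [hae] with x hx
      rw [hx]
    rw [h2, ← lintegral_map (f := fun y ↦ ENNReal.ofReal (exp (t * k y))) (by fun_prop)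
      T.measurable, h₀, hc₀, lintegral_withDensity_eq_lintegral_mul _ (by fun_prop)
      (by fun_prop)] at h1
    refine lt_of_eq_of_lt (lintegral_congr fun y ↦ ?_) h1
    rw [Pi.mul_apply, ← ENNReal.ofReal_mul (exp_pos _).le, ← exp_add]
  -- The parallelogram law yields the constant second differences of the exponents in `hfin`.
  have hpar : ∀ (B : EuclideanSpace ℝ ι →L[ℝ] EuclideanSpace ℝ ι) (y v m : EuclideanSpace ℝ ι),
      ‖B (y + v - m)‖ ^ 2 + ‖B (y - v - m)‖ ^ 2 = 2 * ‖B (y - m)‖ ^ 2 + 2 * ‖B v‖ ^ 2 :=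
    fun B y v m ↦ by
      have := parallelogram_law_with_norm ℝ (B (y - m)) (B v)
      rw [← map_add, ← map_sub, sub_add_eq_add_sub, sub_right_comm] at this
      nlinarith
  have hQ : ∀ (v : EuclideanSpace ℝ ι) (t : ℝ),
      -‖B₀ v‖ ^ 2 / 2 + t * (‖B₀ v‖ ^ 2 / 2 - ‖B₁ v‖ ^ 2 / 2) ≤ 0 := fun v t ↦ by
    refine nonpos_of_lintegral_exp_lt_top (v := v) (by fun_prop) (fun y ↦ ?_) (hfin t)
    simp only [k]
    linear_combination (t - 1) / 2 * hpar B₀ y v φ₀ - t / 2 * hpar B₁ y v φ₁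
  have hnorm : ∀ v, ‖B₀ v‖ ^ 2 = ‖B₁ v‖ ^ 2 := fun v ↦ by
    by_contra hne
    -- In `hQ`, choose `t` so that the left side equals `1`.
    have hδ : ‖B₀ v‖ ^ 2 / 2 - ‖B₁ v‖ ^ 2 / 2 ≠ 0 := fun h ↦ hne (by linarith)
    have := hQ v ((‖B₀ v‖ ^ 2 / 2 + 1) / (‖B₀ v‖ ^ 2 / 2 - ‖B₁ v‖ ^ 2 / 2))
    rw [div_mul_cancel₀ _ hδ] at this
    linarith
  obtain ⟨w, β, hwβ⟩ : ∃ (w : EuclideanSpace ℝ ι) (β : ℝ), ∀ y, k y = ⟪w, y⟫ + β := by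
    refine ⟨B₁.adjoint (B₁ φ₁) - B₀.adjoint (B₀ φ₀),
      c₁ - c₀ - ‖B₁ φ₁‖ ^ 2 / 2 + ‖B₀ φ₀‖ ^ 2 / 2, fun y ↦ ?_⟩
    simp only [k]
    rw [map_sub, map_sub, norm_sub_sq_real, norm_sub_sq_real, hnorm y, inner_sub_left,
      ContinuousLinearMap.adjoint_inner_left, ContinuousLinearMap.adjoint_inner_left,
      real_inner_comm (B₁ φ₁), real_inner_comm (B₀ φ₀)]
    ring
  have hvol : (volume : Measure (EuclideanSpace ℝ ι)) ≪ ν := by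
    rw [ha₀]
    exact withDensity_absolutelyContinuous' (by fun_prop) (.of_forall fun x ↦ by simp [exp_pos])
  refine ⟨w, β - α, ?_⟩
  filter_upwards [hvol.ae_le hae] with x hx
  rw [hwβ] at hx
  linarith

/-! ### Solving the linear system for `T` -/

/-- An almost everywhere linear system for `T` with invertible left side `G` forces `H` to be
invertible, and so determines `T` up to null sets. -/
lemma exists_linearEquiv_of_ae_eq {E F : Type*} [NormedAddCommGroup E] [NormedSpace ℝ E]
    [FiniteDimensional ℝ E] [MeasurableSpace E] [BorelSpace E] [AddCommGroup F] [Module ℝ F]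
    {μ : Measure E} [μ.IsAddHaarMeasure] {T : E → E} (G : E ≃ₗ[ℝ] F) (H : E →ₗ[ℝ] F) (γ : F)
    (h : ∀ᵐ x ∂μ, G x = H (T x) + γ) :
    ∃ (K : E ≃ₗ[ℝ] E) (a : E), ∀ᵐ x ∂μ, T x = K x + a := by
  -- Almost every `x` is good together with its translate by `G.symm z`; subtracting the two
  -- equations exhibits `z` as a value of `H`.
  have hsurj : Function.Surjective H := fun z ↦ by
    have h' : ∀ᵐ x ∂μ, G (x + G.symm z) = H (T (x + G.symm z)) + γ :=
      (measurePreserving_add_right μ (G.symm z)).quasiMeasurePreserving.ae h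
    obtain ⟨x, hx, hx'⟩ := (h.and h').exists
    refine ⟨T (x + G.symm z) - T x, ?_⟩
    rw [map_add, LinearEquiv.apply_symm_apply, hx] at hx'
    rw [map_sub, sub_eq_iff_eq_add]
    exact (add_right_cancel (b := γ) (by rw [← hx']; abel)).symm
  have hbij : Function.Bijective H := by
    have : Function.Surjective (G.symm.toLinearMap ∘ₗ H) := G.symm.surjective.comp hsurj
    have hinj := LinearMap.injective_iff_surjective.2 this
    exact ⟨Function.Injective.of_comp (f := G.symm) hinj, hsurj⟩
  let H' := LinearEquiv.ofBijective H hbij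
  refine ⟨G.trans H'.symm, -H'.symm γ, ?_⟩
  filter_upwards [h] with x hx
  rw [LinearEquiv.trans_apply, hx, ← sub_eq_add_neg, ← map_sub, add_sub_cancel_right]
  exact (H'.symm_apply_apply (T x)).symm

theorem theorem3p1 (n : ℕ)
    (T : EuclideanSpace ℝ (Fin n) ≃ᵐ EuclideanSpace ℝ (Fin n))
    (θ φ : Fin (n + 1) → EuclideanSpace ℝ (Fin n))
    (Ψ : Fin (n + 1) → Matrix (Fin n) (Fin n) ℝ)
    (b : Module.Basis (Fin n) ℝ (EuclideanSpace ℝ (Fin n)))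
    (hb : ∀ j : Fin n, b j = θ j.succ - θ 0)
    (hΨ : ∀ j, (Ψ j).PosDef)
    (hT : ∀ j, (ProbabilityTheory.multivariateGaussian (θ j) (1 : Matrix (Fin n) (Fin n) ℝ)).map T
      = ProbabilityTheory.multivariateGaussian (φ j) (Ψ j)) :
    ∃ (A : Matrix.GeneralLinearGroup (Fin n) ℝ) (a : EuclideanSpace ℝ (Fin n)),
      ∀ᵐ x ∂(MeasureTheory.volume : MeasureTheory.Measure (EuclideanSpace ℝ (Fin n))),
        T x = WithLp.toLp 2 ((A : Matrix (Fin n) (Fin n) ℝ).mulVec x.ofLp) + a := by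
  choose w γ hwγ using fun j : Fin n ↦
    exists_affine_logLikelihoodRatio T (hΨ 0) (hΨ j.succ) (hT 0) (hT j.succ)
  let G₀ : EuclideanSpace ℝ (Fin n) →ₗ[ℝ] Fin n → ℝ :=
    LinearMap.pi fun j ↦ (innerSL ℝ (b j) : EuclideanSpace ℝ (Fin n) →ₗ[ℝ] ℝ)
  have hG₀ : Function.Injective G₀ := by
    rw [← LinearMap.ker_eq_bot, LinearMap.ker_eq_bot']
    intro x hx
    exact InnerProductSpace.ext_inner_left_basis b fun j ↦ by simpa [G₀] using congrFun hx j
  let G := LinearEquiv.ofInjectiveOfFinrankEq G₀ hG₀ (by simp)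
  let H : EuclideanSpace ℝ (Fin n) →ₗ[ℝ] Fin n → ℝ :=
    LinearMap.pi fun j ↦ (innerSL ℝ (w j) : EuclideanSpace ℝ (Fin n) →ₗ[ℝ] ℝ)
  obtain ⟨K, a, hK⟩ := exists_linearEquiv_of_ae_eq (μ := volume) (T := T) G H γ (by
    filter_upwards [ae_all_iff.2 hwγ] with x hx
    ext j
    have := hx j
    rw [← hb j] at this
    exact this)
  let e : EuclideanSpace ℝ (Fin n) ≃ₗ[ℝ] (Fin n → ℝ) := WithLp.linearEquiv 2 ℝ (Fin n → ℝ)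
  refine ⟨Matrix.GeneralLinearGroup.toLin.symm
    (LinearMap.GeneralLinearGroup.ofLinearEquiv ((e.symm.trans K).trans e)), a, ?_⟩
  filter_upwards [hK] with x hx
  rw [hx]
  congr 1
  rw [← Matrix.mulVecLin_apply, ← Matrix.GeneralLinearGroup.coe_toLin, MulEquiv.apply_symm_apply]
  rfl
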